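/- Let $\mathbb K=\mathbb R$ or $\mathbb C$. For a Banach space $X\neq\{0\}$ over $\mathbb K$ and $n\in\mathbb N$, the $n$th linear polarization constant $\mathbf c_n(X)$ is the smallest constant such that $$\|\psi_1\|\cdots\|\psi_n\|\le \mathbf c_n(X)\,\|\psi_1\cdots\psi_n\|$$ for all $\psi_1,\dots,\psi_n\in X^*$ (not necessarily distinct), where $\|\psi_1\cdots\psi_n\|=\sup_{\|x\|=1}|\psi_1(x)\cdots\psi_n(x)|$, and the linear polarization constant of $X$ is $\mathbf c(X)=\lim_{n\to\infty}\mathbf c_n(X)^{1/n}$. Let $\ell_p^d(\mathbb K)$ denote $\mathbb K^d$ with the $\ell_p$-norm. **Theorem.** For every $1\le p\le\infty$ and $d\ge 1$ the smallest constants $\mathbf c_n(\ell_p^d(\mathbb K))$ and the (finite) limit $\mathbf c(\ell_p^d(\mathbb K))$ exist, and the following hold. 1. For every $1\le p\le 2$ there are constants $A,B>0$, independent of $d$, such that $A\,d^{1/p}\le \mathbf c(\ell_p^d(\mathbb K))\le B\,d^{1/p}$ for all $d\ge 1$. 2. For every $2\le p<\infty$ there are constants $A,B>0$, independent of $d$,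 such that $A\sqrt d\le \mathbf c(\ell_p^d(\mathbb K))\le B\sqrt d$ for all $d\ge 1$. 3. There are constants $A,B>0$, independent of $d$, such that $A\sqrt d\le \mathbf c(\ell_\infty^d(\mathbb K))$ for all $d\ge 1$ and $\mathbf c(\ell_\infty^d(\mathbb K))\le B\sqrt{d\log d}$ for all $d\ge 2$. -/

import Mathlib

open Filter Topology
open scoped ENNReal

noncomputable section

/-- The `d`-dimensional space `ℓ_p^d(𝕜)`. -/
abbrev EllP (𝕜 : Type*) (p : ℝ≥0∞) (d : ℕ) : Type _ := PiLp p (fun _ : Fin d => 𝕜)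

/-- The norm of the `n`-homogeneous polynomial `ψ₁ ⋯ ψₙ` (pointwise product): the supremum of its
modulus over the unit sphere of `X`. -/
def prodNorm {𝕜 X : Type*} [RCLike 𝕜] [NormedAddCommGroup X] [NormedSpace 𝕜 X] {n : ℕ}
    (ψ : Fin n → StrongDual 𝕜 X) : ℝ :=
  ⨆ x : Metric.sphere (0 : X) 1, ‖∏ j, ψ j (x : X)‖

/-- The constants `C` with `‖ψ₁‖ ⋯ ‖ψₙ‖ ≤ C ‖ψ₁ ⋯ ψₙ‖` for all families of `n` functionals
(repetitions allowed). -/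
def polarizationBounds (𝕜 X : Type*) [RCLike 𝕜] [NormedAddCommGroup X] [NormedSpace 𝕜 X]
    (n : ℕ) : Set ℝ :=
  {C | ∀ ψ : Fin n → StrongDual 𝕜 X, ∏ j, ‖ψ j‖ ≤ C * prodNorm ψ}

/-- The `n`th linear polarization constant `c_n(X)`. -/
def nthPolarizationConst (𝕜 X : Type*) [RCLike 𝕜] [NormedAddCommGroup X] [NormedSpace 𝕜 X]
    (n : ℕ) : ℝ :=
  sInf (polarizationBounds 𝕜 X n)

/-- The linear polarization constant `c(X) = lim_n c_n(X)^{1/n}`. -/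
def polarizationConst (𝕜 X : Type*) [RCLike 𝕜] [NormedAddCommGroup X] [NormedSpace 𝕜 X] : ℝ :=
  limUnder atTop (fun n : ℕ => nthPolarizationConst 𝕜 X n ^ (1 / (n : ℝ)))

/-- `a_d ≺ b_d` for sequences indexed by the integers `d ≥ d₀`. -/
def PrecFrom (d₀ : ℕ) (a b : ℕ → ℝ) : Prop :=
  ∃ L : ℝ, 0 < L ∧ ∀ d : ℕ, d₀ ≤ d → a d ≤ L * b d

/-- `a_d ≍ b_d` for sequences indexed by the integers `d ≥ d₀`. -/
def AsympFrom (d₀ : ℕ) (a b : ℕ → ℝ) : Prop :=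
  PrecFrom d₀ a b ∧ PrecFrom d₀ b a

end

/-!
The constants `c_n(X)` are supermultiplicative, because the product of two families of functionals
has norm at most the product of the norms. So as soon as `c_n(X) ≤ C ^ n` for some `C`, Fekete's
lemma shows that `c_n(X)^{1/n}` converges to its supremum (`tendsto_nthPolarizationConst`). Both
kinds of estimates for `c(ℓ_p^d)` reduce to this: an exponential bound on `c_n` bounds `c` from
above, and a single finite family of functionals bounds it from below.

*Lower bounds.* By the AM-GM inequality, it is enough to control a power mean of the values of the
functionals on the unit sphere (`le_mul_polarizationConst`). The `d` coordinate functionals give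
`d ^ (1/p)`, since the `p`-th powers of the coordinates of a unit vector sum to `1`
(`rpow_le_polarizationConst`). For `p ≥ 2` the `2 ^ d` functionals with coefficients `±1` have norm
`d ^ (1 - 1/p)`, while the quadratic mean of their values at `x` is
`‖x‖₂ ≤ d ^ (1/2 - 1/p) ‖x‖_p`; the quotient is `√d` (`sqrt_le_polarizationConst`).

*Upper bounds.* Given functionals with coefficient vectors `a j`, let `x` be a standard Gaussian
vector. Then `⟨a j, x⟩` is Gaussian with standard deviation comparable to `‖a j‖₂`, so
`E (‖a j‖₂ / |⟨a j, x⟩|)^{1/2}` is bounded by an absolute constant. Averaging these quantities over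
`j` together with a weight which controls the norm of `x`, one finds a vector `x` which is small in
`ℓ_p^d` and for which AM-GM yields `∏ ‖a j‖₂ ≤ K ^ n ∏ |⟨a j, x⟩|` (`exists_prod_le_of_gaussian`).
With `ψ_j` the `j`-th functional, `‖ψ_j‖ ≤ N ‖a j‖₂`, where `N` is the constant in
`‖y‖₂ ≤ N ‖y‖_p`. The size of `x` is of order `d ^ (1/p)` for finite `p` (weight `|t| ^ p`) and
`√(log d)` for `p = ∞` (weight `exp (t ^ 2 / 4)`); multiplied by `N = 1` for `p ≤ 2` and
`N = d ^ (1/2 - 1/p)` for `p ≥ 2`, this gives the three upper bounds.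
-/

/-! ### Linear polarization constants of a normed space -/

/-- A form of the AM-GM inequality: if the arithmetic mean of the `z i` is at most `M`, then so is
their geometric mean. -/
lemma prod_le_pow_card_of_sum_le {ι : Type*} (s : Finset ι) (z : ι → ℝ) {M : ℝ}
    (hz : ∀ i ∈ s, 0 ≤ z i) (h : ∑ i ∈ s, z i ≤ s.card * M) : ∏ i ∈ s, z i ≤ M ^ s.card := by
  rcases s.eq_empty_or_nonempty with rfl | hs
  · simp
  have hc : (0 : ℝ) < s.card := by exact_mod_cast hs.card_pos
  have key := Real.geom_mean_le_arith_mean s (fun _ => 1) z (by simp) (by simpa using hc) hz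
  simp only [Real.rpow_one, Finset.sum_const, nsmul_eq_mul, mul_one, one_mul] at key
  have hP : 0 ≤ ∏ i ∈ s, z i := Finset.prod_nonneg hz
  have h2 : (∏ i ∈ s, z i) ^ ((s.card : ℝ)⁻¹) ≤ M :=
    key.trans (by rw [div_le_iff₀ hc]; linarith)
  calc ∏ i ∈ s, z i = ((∏ i ∈ s, z i) ^ ((s.card : ℝ)⁻¹)) ^ s.card := by
        rw [Real.rpow_inv_natCast_pow hP hs.card_pos.ne']
    _ ≤ M ^ s.card := pow_le_pow_left₀ (by positivity) h2 _

section General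

variable {𝕜 X : Type*} [RCLike 𝕜] [NormedAddCommGroup X] [NormedSpace 𝕜 X]

lemma prodNorm_nonneg {n : ℕ} (ψ : Fin n → StrongDual 𝕜 X) : 0 ≤ prodNorm ψ :=
  Real.iSup_nonneg fun _ => norm_nonneg _

lemma prodNorm_le {n : ℕ} {ψ : Fin n → StrongDual 𝕜 X} {M : ℝ} (hM : 0 ≤ M)
    (h : ∀ x : X, ‖x‖ = 1 → ‖∏ j, ψ j x‖ ≤ M) : prodNorm ψ ≤ M :=
  Real.iSup_le (fun x => h x (by simp)) hM

lemma norm_prod_apply_le {n : ℕ} (ψ : Fin n → StrongDual 𝕜 X) {x : X} (hx : ‖x‖ = 1) :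
    ‖∏ j, ψ j x‖ ≤ ∏ j, ‖ψ j‖ := by
  rw [norm_prod]
  exact Finset.prod_le_prod (fun _ _ => norm_nonneg _)
    fun j _ => by simpa [hx] using (ψ j).le_opNorm x

lemma prodNorm_le_prod_norm {n : ℕ} (ψ : Fin n → StrongDual 𝕜 X) : prodNorm ψ ≤ ∏ j, ‖ψ j‖ :=
  prodNorm_le (Finset.prod_nonneg fun _ _ => norm_nonneg _) fun _ hx => norm_prod_apply_le ψ hx

lemma le_prodNorm {n : ℕ} (ψ : Fin n → StrongDual 𝕜 X) {x : X} (hx : ‖x‖ = 1) :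
    ‖∏ j, ψ j x‖ ≤ prodNorm ψ := by
  refine le_ciSup (f := fun x : Metric.sphere (0 : X) 1 => ‖∏ j, ψ j (x : X)‖) ?_
    ⟨x, by simpa using hx⟩
  refine ⟨∏ j, ‖ψ j‖, ?_⟩
  rintro _ ⟨y, rfl⟩
  exact norm_prod_apply_le ψ (by simp)

lemma norm_prod_apply_le_pow_mul_prodNorm {n : ℕ} (ψ : Fin n → StrongDual 𝕜 X) {x : X}
    (hx : x ≠ 0) : ‖∏ j, ψ j x‖ ≤ ‖x‖ ^ n * prodNorm ψ := by
  have hx' : ‖x‖ ≠ 0 := norm_ne_zero_iff.2 hx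
  have h := le_prodNorm ψ (x := ((‖x‖⁻¹ : ℝ) : 𝕜) • x) (by
    rw [norm_smul, RCLike.norm_ofReal, abs_of_nonneg (by positivity), inv_mul_cancel₀ hx'])
  simp only [map_smul, smul_eq_mul, Finset.prod_mul_distrib, Finset.prod_const, Finset.card_univ,
    Fintype.card_fin, norm_mul, norm_pow, RCLike.norm_ofReal, abs_inv, abs_norm] at h
  calc ‖∏ j, ψ j x‖ = ‖x‖ ^ n * (‖x‖⁻¹ ^ n * ‖∏ j, ψ j x‖) := by
        rw [← mul_assoc, ← mul_pow, mul_inv_cancel₀ hx', one_pow, one_mul]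
    _ ≤ _ := by gcongr

lemma prodNorm_append_le {m n : ℕ} (ψ : Fin m → StrongDual 𝕜 X) (φ : Fin n → StrongDual 𝕜 X) :
    prodNorm (Fin.append ψ φ) ≤ prodNorm ψ * prodNorm φ := by
  refine prodNorm_le (mul_nonneg (prodNorm_nonneg ψ) (prodNorm_nonneg φ)) fun x hx => ?_
  simp only [Fin.prod_univ_add, Fin.append_left, Fin.append_right, norm_mul]
  exact mul_le_mul (le_prodNorm ψ hx) (le_prodNorm φ hx) (norm_nonneg _) (prodNorm_nonneg ψ)

lemma one_le_of_mem_polarizationBounds [Nontrivial X] {n : ℕ} {C : ℝ}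
    (hC : C ∈ polarizationBounds 𝕜 X n) : 1 ≤ C := by
  obtain ⟨x, hx⟩ := exists_ne (0 : X)
  obtain ⟨g, hg, -⟩ := exists_dual_vector 𝕜 x (norm_ne_zero_iff.2 hx)
  have h1 : 1 ≤ C * prodNorm (fun _ : Fin n => g) := by simpa [hg] using hC fun _ => g
  have h2 : prodNorm (fun _ : Fin n => g) ≤ 1 := by
    simpa [hg] using prodNorm_le_prod_norm (fun _ : Fin n => g)
  have h3 := prodNorm_nonneg (fun _ : Fin n => g)
  have h4 : 0 < prodNorm (fun _ : Fin n => g) := by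
    refine h3.lt_of_ne fun h0 => ?_
    rw [← h0, mul_zero] at h1
    exact absurd h1 (by norm_num)
  by_contra! h
  nlinarith

lemma isLeast_nthPolarizationConst [Nontrivial X] {n : ℕ}
    (h : (polarizationBounds 𝕜 X n).Nonempty) :
    IsLeast (polarizationBounds 𝕜 X n) (nthPolarizationConst 𝕜 X n) := by
  have hb : BddBelow (polarizationBounds 𝕜 X n) :=
    ⟨1, fun _ => one_le_of_mem_polarizationBounds⟩
  refine ⟨IsClosed.csInf_mem ?_ h hb, fun C hC => csInf_le hb hC⟩
  simp only [polarizationBounds, Set.ofPred_forall]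
  exact isClosed_iInter fun ψ => isClosed_le continuous_const (by fun_prop)

/-- Concatenating families of `m` and of `n` functionals shows that the constants `c_n(X)` are
supermultiplicative. -/
lemma nthPolarizationConst_mul_le [Nontrivial X]
    (h : ∀ n, (polarizationBounds 𝕜 X n).Nonempty) (m n : ℕ) :
    nthPolarizationConst 𝕜 X m * nthPolarizationConst 𝕜 X n ≤ nthPolarizationConst 𝕜 X (m + n) := by
  have hl := fun n => isLeast_nthPolarizationConst (h n)
  have hpos : ∀ n, 0 < nthPolarizationConst 𝕜 X n := fun n =>
    one_pos.trans_le (one_le_of_mem_polarizationBounds (hl n).1)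
  have key : ∀ (ψ : Fin m → StrongDual 𝕜 X) (φ : Fin n → StrongDual 𝕜 X),
      (∏ j, ‖ψ j‖) * ∏ j, ‖φ j‖ ≤
        nthPolarizationConst 𝕜 X (m + n) * (prodNorm ψ * prodNorm φ) := fun ψ φ => by
    have := (hl (m + n)).1 (Fin.append ψ φ)
    simp only [Fin.prod_univ_add, Fin.append_left, Fin.append_right] at this
    exact this.trans (mul_le_mul_of_nonneg_left (prodNorm_append_le ψ φ) (hpos _).le)
  have step : ∀ φ : Fin n → StrongDual 𝕜 X, nthPolarizationConst 𝕜 X m * ∏ j, ‖φ j‖ ≤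
      nthPolarizationConst 𝕜 X (m + n) * prodNorm φ := fun φ => by
    rcases (Finset.prod_nonneg fun j (_ : j ∈ Finset.univ) => norm_nonneg (φ j)).eq_or_lt with
      h0 | h0
    · rw [← h0, mul_zero]
      exact mul_nonneg (hpos _).le (prodNorm_nonneg _)
    · rw [← le_div_iff₀ h0]
      refine (hl m).2 fun ψ => ?_
      rw [div_mul_eq_mul_div, le_div_iff₀ h0]
      exact (key ψ φ).trans_eq (by ring)
  have : nthPolarizationConst 𝕜 X n ≤
      nthPolarizationConst 𝕜 X (m + n) / nthPolarizationConst 𝕜 X m := by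
    refine (hl n).2 fun φ => ?_
    rw [div_mul_eq_mul_div, le_div_iff₀ (hpos m), mul_comm]
    exact step φ
  rwa [le_div_iff₀ (hpos m), mul_comm] at this

/-- By Fekete's lemma, an exponential bound on the constants `c_n(X)` makes `c_n(X)^{1/n}` converge
to its supremum. -/
lemma tendsto_nthPolarizationConst [Nontrivial X] {C : ℝ}
    (hC : ∀ n, C ^ n ∈ polarizationBounds 𝕜 X n) :
    Tendsto (fun n : ℕ => nthPolarizationConst 𝕜 X n ^ (1 / (n : ℝ))) atTop
      (𝓝 (polarizationConst 𝕜 X)) ∧ polarizationConst 𝕜 X ≤ C ∧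
    ∀ n ≠ 0, nthPolarizationConst 𝕜 X n ≤ polarizationConst 𝕜 X ^ n := by
  have hne : ∀ n, (polarizationBounds 𝕜 X n).Nonempty := fun n => ⟨_, hC n⟩
  have hl := fun n => isLeast_nthPolarizationConst (hne n)
  have hpos : ∀ n, 0 < nthPolarizationConst 𝕜 X n := fun n =>
    one_pos.trans_le (one_le_of_mem_polarizationBounds (hl n).1)
  have hC1 : 1 ≤ C := by simpa using one_le_of_mem_polarizationBounds (hC 1)
  have hC0 : 0 < C := one_pos.trans_le hC1
  set u : ℕ → ℝ := fun n => -Real.log (nthPolarizationConst 𝕜 X n) with hu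
  have hsub : Subadditive u := fun m n => by
    have := Real.log_le_log (mul_pos (hpos m) (hpos n)) (nthPolarizationConst_mul_le hne m n)
    rw [Real.log_mul (hpos m).ne' (hpos n).ne'] at this
    simp only [hu]
    linarith
  have hlog : ∀ n, Real.log (nthPolarizationConst 𝕜 X n) ≤ n * Real.log C := fun n => by
    rw [← Real.log_pow]
    exact Real.log_le_log (hpos n) ((hl n).2 (hC n))
  have hbdd : BddBelow (Set.range fun n : ℕ => u n / n) := by
    refine ⟨-Real.log C, ?_⟩
    rintro _ ⟨n, rfl⟩
    rcases n.eq_zero_or_pos with rfl | hn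
    · simpa using Real.log_nonneg hC1
    · have hn' : (0 : ℝ) < n := by exact_mod_cast hn
      simp only [hu]
      rw [le_div_iff₀ hn']
      linarith [hlog n]
  have hexp : ∀ n : ℕ, nthPolarizationConst 𝕜 X n ^ (1 / (n : ℝ)) = Real.exp (-(u n / n)) :=
    fun n => by
      rw [Real.rpow_def_of_pos (hpos n)]
      simp only [hu]
      ring_nf
  have ht : Tendsto (fun n : ℕ => nthPolarizationConst 𝕜 X n ^ (1 / (n : ℝ))) atTop
      (𝓝 (Real.exp (-hsub.lim))) := by
    simp only [hexp]
    exact (Real.continuous_exp.tendsto _).comp (hsub.tendsto_lim hbdd).neg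
  have heq : polarizationConst 𝕜 X = Real.exp (-hsub.lim) := ht.limUnder_eq
  refine ⟨heq ▸ ht, ?_, fun n hn => ?_⟩
  · rw [heq]
    refine le_of_tendsto ht (eventually_ge_atTop 1 |>.mono fun n hn => ?_)
    calc nthPolarizationConst 𝕜 X n ^ (1 / (n : ℝ)) ≤ (C ^ n) ^ (1 / (n : ℝ)) :=
          Real.rpow_le_rpow (hpos n).le ((hl n).2 (hC n)) (by positivity)
      _ = C := by rw [one_div, Real.pow_rpow_inv_natCast hC0.le (by lia)]
  · have h1 := hsub.lim_le_div hbdd hn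
    have hn' : (0 : ℝ) < n := by exact_mod_cast Nat.pos_of_ne_zero hn
    rw [heq, ← Real.exp_nat_mul, ← Real.log_le_iff_le_exp (hpos n)]
    rw [le_div_iff₀ hn'] at h1
    simp only [hu] at h1
    linarith

/-- Lower bound for `c(X)` from one finite family of functionals of norm at least `r` whose
`s`-th power means on the unit sphere are at most `M`. -/
lemma le_mul_polarizationConst [Nontrivial X] {C : ℝ}
    (hC : ∀ n, C ^ n ∈ polarizationBounds 𝕜 X n) {ι : Type*} [Fintype ι] [Nonempty ι]
    (ψ : ι → StrongDual 𝕜 X) {r M s : ℝ} (hr : 0 ≤ r) (hM : 0 ≤ M) (hs : 0 < s)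
    (hψ : ∀ i, r ≤ ‖ψ i‖)
    (h : ∀ x : X, ‖x‖ = 1 → ∑ i, ‖ψ i x‖ ^ s ≤ Fintype.card ι * M ^ s) :
    r ≤ M * polarizationConst 𝕜 X := by
  obtain ⟨ht, -, hle⟩ := tendsto_nthPolarizationConst hC
  have hl := fun n => isLeast_nthPolarizationConst (𝕜 := 𝕜) (X := X) ⟨_, hC n⟩
  have hc0 : 0 ≤ polarizationConst 𝕜 X := by
    refine ge_of_tendsto' ht fun n => Real.rpow_nonneg ?_ _
    exact zero_le_one.trans (one_le_of_mem_polarizationBounds (hl n).1)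
  set n := Fintype.card ι with hn
  have hn0 : n ≠ 0 := Fintype.card_ne_zero
  let e : Fin n ≃ ι := (Fintype.equivFin ι).symm
  have hP : prodNorm (fun j => ψ (e j)) ≤ M ^ n := by
    refine prodNorm_le (by positivity) fun x hx => ?_
    rw [norm_prod, e.prod_comp (fun i => ‖ψ i x‖)]
    have := prod_le_pow_card_of_sum_le Finset.univ (fun i => ‖ψ i x‖ ^ s) (M := M ^ s)
      (fun _ _ => by positivity) (by simpa using h x hx)
    rw [Real.finsetProd_rpow _ _ (fun _ _ => norm_nonneg _), Finset.card_univ, ← Real.rpow_natCast,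
      ← Real.rpow_mul hM, mul_comm, Real.rpow_mul hM, Real.rpow_natCast] at this
    exact (Real.rpow_le_rpow_iff (Finset.prod_nonneg fun _ _ => norm_nonneg _) (by positivity)
      hs).1 this
  have h1 : r ^ n ≤ (M * polarizationConst 𝕜 X) ^ n := calc
    r ^ n = ∏ _j : Fin n, r := by simp
    _ ≤ ∏ j, ‖ψ (e j)‖ := Finset.prod_le_prod (fun _ _ => hr) fun j _ => hψ _
    _ ≤ nthPolarizationConst 𝕜 X n * prodNorm (fun j => ψ (e j)) := (hl n).1 _
    _ ≤ polarizationConst 𝕜 X ^ n * M ^ n :=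
      mul_le_mul (hle n hn0) hP (prodNorm_nonneg _) (by positivity)
    _ = _ := by rw [mul_pow, mul_comm]
  exact le_of_pow_le_pow_left₀ hn0 (by positivity) h1

end General

/-! ### Functionals on `ℓ_p^d` -/

section EllP

variable {𝕜 : Type*} [RCLike 𝕜] {p : ℝ≥0∞} [Fact (1 ≤ p)] {d : ℕ}

lemma toReal_pos_of_one_le (hp : p ≠ ∞) : 0 < p.toReal :=
  ENNReal.toReal_pos (zero_lt_one.trans_le Fact.out).ne' hp

lemma sum_norm_rpow_eq_one (hp : p ≠ ∞) {x : EllP 𝕜 p d} (hx : ‖x‖ = 1) :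
    ∑ i, ‖x i‖ ^ p.toReal = 1 := by
  have h0 := toReal_pos_of_one_le hp
  rw [PiLp.norm_eq_sum h0, one_div] at hx
  have := congrArg (· ^ p.toReal) hx
  simpa [Real.rpow_inv_rpow (Finset.sum_nonneg fun i _ => Real.rpow_nonneg (norm_nonneg (x i)) _)
    h0.ne'] using this

lemma sum_sq_le_of_le_two (hp : p ≤ 2) {x : EllP 𝕜 p d} (hx : ‖x‖ = 1) :
    ∑ i, ‖x i‖ ^ 2 ≤ 1 := by
  have hp' : p ≠ ∞ := ne_top_of_le_ne_top (by simp) hp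
  have h2 : p.toReal ≤ 2 := by simpa using ENNReal.toReal_mono (by simp) hp
  rw [← sum_norm_rpow_eq_one hp' hx]
  refine Finset.sum_le_sum fun i _ => ?_
  rw [← Real.rpow_natCast]
  refine Real.rpow_le_rpow_of_exponent_ge' (norm_nonneg _) ?_ ENNReal.toReal_nonneg
    (by exact_mod_cast h2)
  exact (PiLp.norm_apply_le x i).trans_eq hx

/-- Hölder comparison of the `ℓ_2` and `ℓ_p` norms. For `p = ∞` the exponent `1 / p.toReal` is `0`,
which is the correct value. -/
lemma sum_sq_le_of_two_le (hp : 2 ≤ p) (hd : 1 ≤ d) {x : EllP 𝕜 p d} (hx : ‖x‖ = 1) :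
    ∑ i, ‖x i‖ ^ 2 ≤ ((d : ℝ) ^ (1 / 2 - 1 / p.toReal)) ^ 2 := by
  have hd0 : (0 : ℝ) < d := by exact_mod_cast hd
  rw [← Real.rpow_mul_natCast hd0.le]
  rcases eq_or_ne p ∞ with rfl | hp'
  · calc ∑ i, ‖x i‖ ^ 2 ≤ ∑ _i : Fin d, (1 : ℝ) := Finset.sum_le_sum fun i _ => by
          have := (PiLp.norm_apply_le x i).trans_eq hx
          exact pow_le_one₀ (norm_nonneg _) this
      _ = _ := by simp
  · have h0 := toReal_pos_of_one_le hp'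
    have h2 : 2 ≤ p.toReal := by simpa using ENNReal.toReal_mono hp' hp
    have key := Real.rpow_sum_le_const_mul_sum_rpow_of_nonneg Finset.univ
      (f := fun i => ‖x i‖ ^ 2) (p := p.toReal / 2) (by linarith) (fun i _ => by positivity)
    have hpow : ∀ i, (‖x i‖ ^ 2) ^ (p.toReal / 2) = ‖x i‖ ^ p.toReal := fun i => by
      rw [← Real.rpow_natCast_mul (norm_nonneg _)]
      congr 1
      push_cast
      ring
    simp only [hpow, sum_norm_rpow_eq_one hp' hx, mul_one, Finset.card_univ,
      Fintype.card_fin] at key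
    have key2 := (Real.le_rpow_inv_iff_of_pos (by positivity) (by positivity)
      (show 0 < p.toReal / 2 by positivity)).2 key
    rw [← Real.rpow_mul hd0.le] at key2
    refine key2.trans_eq ?_
    congr 1
    push_cast
    field_simp

lemma norm_eq_of_norm_apply_eq_one (hd : 1 ≤ d) {x : EllP 𝕜 p d} (hx : ∀ i, ‖x i‖ = 1) :
    ‖x‖ = (d : ℝ) ^ (1 / p.toReal) := by
  have : Nonempty (Fin d) := ⟨⟨0, hd⟩⟩
  rcases eq_or_ne p ∞ with rfl | hp'
  · simp [PiLp.norm_eq_ciSup, hx]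
  · simp [PiLp.norm_eq_sum (toReal_pos_of_one_le hp'), hx]

lemma apply_eq_sum {p : ℝ≥0∞} (ψ : StrongDual 𝕜 (EllP 𝕜 p d)) (x : EllP 𝕜 p d) :
    ψ x = ∑ i, x i * ψ (PiLp.single p i 1) := by
  have hx : x = ∑ i, x i • PiLp.single p i (1 : 𝕜) := by
    ext j
    simp [Pi.single_apply]
  conv_lhs => rw [hx]
  simp

/-- The norm of a functional is controlled by the Euclidean norm of its coefficients, with the
constant that compares the `ℓ_2` and `ℓ_p` norms of vectors. -/
lemma norm_le_mul_sqrt_sum (ψ : StrongDual 𝕜 (EllP 𝕜 p d)) {N : ℝ} (hN : 0 ≤ N)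
    (h : ∀ x : EllP 𝕜 p d, ‖x‖ = 1 → ∑ i, ‖x i‖ ^ 2 ≤ N ^ 2) :
    ‖ψ‖ ≤ N * √(∑ i, ‖ψ (PiLp.single p i 1)‖ ^ 2) := by
  refine ContinuousLinearMap.opNorm_le_of_unit_norm (𝕜 := 𝕜) (by positivity) fun x hx => ?_
  rw [apply_eq_sum ψ x]
  calc ‖∑ i, x i * ψ (PiLp.single p i 1)‖ ≤ ∑ i, ‖x i‖ * ‖ψ (PiLp.single p i 1)‖ := by
        simpa only [norm_mul] using norm_sum_le Finset.univ
          fun i => x i * ψ (PiLp.single p i 1)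
    _ ≤ √(∑ i, ‖x i‖ ^ 2) * √(∑ i, ‖ψ (PiLp.single p i 1)‖ ^ 2) :=
        Real.sum_mul_le_sqrt_mul_sqrt _ _ _
    _ ≤ _ := by
        gcongr
        exact Real.sqrt_le_iff.2 ⟨hN, h x hx⟩

/-- The coordinate functionals have norm one, and on the unit sphere of `ℓ_p^d` the `p`-th power
mean of their values is `d⁻¹`. -/
lemma rpow_le_polarizationConst (hp : p ≠ ∞) (hd : 1 ≤ d) {C : ℝ}
    (hC : ∀ n, C ^ n ∈ polarizationBounds 𝕜 (EllP 𝕜 p d) n) :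
    (d : ℝ) ^ (1 / p.toReal) ≤ polarizationConst 𝕜 (EllP 𝕜 p d) := by
  have : Nonempty (Fin d) := ⟨⟨0, hd⟩⟩
  have hd0 : (0 : ℝ) < d := by exact_mod_cast hd
  have h0 := toReal_pos_of_one_le hp
  have key := le_mul_polarizationConst hC (fun i : Fin d => PiLp.proj (𝕜 := 𝕜) p (fun _ => 𝕜) i)
    (r := 1) (M := (d : ℝ) ^ (-(1 / p.toReal))) (s := p.toReal) zero_le_one (by positivity) h0
    (fun i => by
      simpa using (PiLp.proj (𝕜 := 𝕜) p (fun _ => 𝕜) i).le_opNorm (PiLp.single p i 1))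
    (fun x hx => by
      rw [← Real.rpow_mul hd0.le, neg_mul, one_div_mul_cancel h0.ne', Real.rpow_neg_one,
        Fintype.card_fin, mul_inv_cancel₀ hd0.ne']
      exact (sum_norm_rpow_eq_one hp hx).le)
  rwa [Real.rpow_neg hd0.le, ← div_eq_inv_mul, le_div_iff₀ (by positivity), one_mul] at key

/-- Khintchine's identity: the mean of `|∑ ± x i|²` over all choices of signs is the square of the
Euclidean norm of `x`. -/
lemma sum_signs_norm_sq (x : Fin d → 𝕜) :
    ∑ ε : Fin d → ℤˣ, ‖∑ i, ((ε i : ℤ) : 𝕜) * x i‖ ^ 2 =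
      Fintype.card (Fin d → ℤˣ) * ∑ i, ‖x i‖ ^ 2 := by
  have horth : ∀ i j, i ≠ j → ∑ ε : Fin d → ℤˣ, ((ε i : ℤ) : 𝕜) * ((ε j : ℤ) : 𝕜) = 0 := by
    intro i j hij
    -- changing the sign of the `i`-th coordinate permutes the sign vectors
    have h := Equiv.sum_comp (Equiv.mulLeft (Pi.mulSingle i (-1) : Fin d → ℤˣ))
      fun ε : Fin d → ℤˣ => ((ε i : ℤ) : 𝕜) * ((ε j : ℤ) : 𝕜)
    simp only [Equiv.coe_mulLeft, Pi.mul_apply, Pi.mulSingle_eq_same,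
      Pi.mulSingle_eq_of_ne hij.symm, one_mul, neg_mul, Units.val_neg, Int.cast_neg,
      Finset.sum_neg_distrib] at h
    exact CharZero.eq_neg_self_iff.1 h.symm
  have hdiag : ∀ (ε : Fin d → ℤˣ) i, ((ε i : ℤ) : 𝕜) * ((ε i : ℤ) : 𝕜) = 1 := fun ε i => by
    rw [← Int.cast_mul, ← Units.val_mul, Int.units_mul_self]
    simp
  have hexp : ∀ ε : Fin d → ℤˣ, ((‖∑ i, ((ε i : ℤ) : 𝕜) * x i‖ ^ 2 : ℝ) : 𝕜) =
      ∑ i, ∑ j, (((ε i : ℤ) : 𝕜) * ((ε j : ℤ) : 𝕜)) * (x i * (starRingEnd 𝕜) (x j)) := fun ε => by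
    push_cast
    rw [← RCLike.mul_conj, map_sum, Finset.sum_mul_sum]
    refine Finset.sum_congr rfl fun i _ => Finset.sum_congr rfl fun j _ => ?_
    rw [map_mul, map_intCast]
    ring
  have : ((∑ ε : Fin d → ℤˣ, ‖∑ i, ((ε i : ℤ) : 𝕜) * x i‖ ^ 2 : ℝ) : 𝕜) =
      ((Fintype.card (Fin d → ℤˣ) * ∑ i, ‖x i‖ ^ 2 : ℝ) : 𝕜) := by
    rw [RCLike.ofReal_sum]
    simp only [hexp]
    rw [Finset.sum_comm]
    push_cast
    rw [Finset.mul_sum]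
    refine Finset.sum_congr rfl fun i _ => ?_
    rw [Finset.sum_comm, Finset.sum_eq_single i]
    · rw [← Finset.sum_mul]
      simp [hdiag, RCLike.mul_conj]
    · intro j _ hj
      rw [← Finset.sum_mul, horth i j hj.symm, zero_mul]
    · simp
  exact_mod_cast this

/-- The functionals with coefficients `±1` have norm at least `d ^ (1 - 1/p)`, and by orthogonality
of signs the quadratic mean of their values at `x` is the Euclidean norm of `x`. -/
lemma sqrt_le_polarizationConst (hp : 2 ≤ p) (hd : 1 ≤ d) {C : ℝ}
    (hC : ∀ n, C ^ n ∈ polarizationBounds 𝕜 (EllP 𝕜 p d) n) :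
    √(d : ℝ) ≤ polarizationConst 𝕜 (EllP 𝕜 p d) := by
  have : Nonempty (Fin d) := ⟨⟨0, hd⟩⟩
  have hd0 : (0 : ℝ) < d := by exact_mod_cast hd
  let ψ : (Fin d → ℤˣ) → StrongDual 𝕜 (EllP 𝕜 p d) :=
    fun ε => ∑ i, ((ε i : ℤ) : 𝕜) • PiLp.proj p (fun _ => 𝕜) i
  have hψ : ∀ ε x, ψ ε x = ∑ i, ((ε i : ℤ) : 𝕜) * x i := fun ε x => by simp [ψ]
  have key := le_mul_polarizationConst hC ψ (r := (d : ℝ) ^ (1 - 1 / p.toReal))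
    (M := (d : ℝ) ^ (1 / 2 - 1 / p.toReal)) (s := 2) (by positivity) (by positivity) (by norm_num)
    (fun ε => by
      let x : EllP 𝕜 p d := WithLp.toLp p fun i => ((ε i : ℤ) : 𝕜)
      have hx : ‖x‖ = (d : ℝ) ^ (1 / p.toReal) := norm_eq_of_norm_apply_eq_one hd fun i => by
        rcases Int.units_eq_one_or (ε i) with h | h <;> simp [x, h]
      have h1 : ψ ε x = (d : 𝕜) := by
        rw [hψ]
        have : ∀ i, ((ε i : ℤ) : 𝕜) * x i = 1 := fun i => by
          rcases Int.units_eq_one_or (ε i) with h | h <;> simp [x, h]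
        simp [this]
      have h2 := (ψ ε).le_opNorm x
      rw [h1, hx, RCLike.norm_natCast] at h2
      rwa [Real.rpow_sub hd0, Real.rpow_one, div_le_iff₀ (by positivity)])
    (fun x hx => by
      simp only [hψ, Real.rpow_two]
      rw [sum_signs_norm_sq]
      gcongr
      exact sum_sq_le_of_two_le hp hd hx)
  rw [show (1 : ℝ) - 1 / p.toReal = (1 / 2 - 1 / p.toReal) + 1 / 2 by ring,
    Real.rpow_add hd0, ← Real.sqrt_eq_rpow] at key
  exact le_of_mul_le_mul_left key (by positivity)

end EllP

/-! ### Negative moments of Gaussian linear forms -/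

section Gaussian

open MeasureTheory ProbabilityTheory

/-- The standard Gaussian measure on `ℝ^d`. -/
noncomputable abbrev gaussianPi (d : ℕ) : Measure (Fin d → ℝ) :=
  Measure.pi fun _ => gaussianReal 0 1

lemma intervalIntegrable_abs_rpow :
    IntervalIntegrable (fun x : ℝ => |x| ^ (-(1 / 2) : ℝ)) volume (-1) 1 := by
  have h1 : IntervalIntegrable (fun x : ℝ => |x| ^ (-(1 / 2) : ℝ)) volume 0 1 := by
    refine (intervalIntegral.intervalIntegrable_rpow' (r := -(1 / 2)) (by norm_num)).congr ?_
    intro x hx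
    rw [Set.uIoc_of_le zero_le_one] at hx
    simp only [abs_of_pos hx.1]
  have h2 := (IntervalIntegrable.iff_comp_neg (by simp)).1 h1
  simp only [abs_neg, neg_zero] at h2
  exact h2.symm.trans h1

lemma gaussianReal_le_volume : gaussianReal 0 1 ≤ volume := by
  rw [gaussianReal_of_var_ne_zero 0 one_ne_zero]
  calc volume.withDensity (gaussianPDF 0 1) ≤ volume.withDensity 1 := by
        refine withDensity_mono (ae_of_all _ fun x => ?_)
        rw [gaussianPDF, Pi.one_apply, ENNReal.ofReal_le_one, gaussianPDFReal]
        have h1 : (1 : ℝ) ≤ √(2 * Real.pi * ((1 : NNReal) : ℝ)) := by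
          rw [Real.one_le_sqrt]
          have := Real.pi_gt_three
          push_cast
          linarith
        have h2 : Real.exp (-(x - 0) ^ 2 / (2 * ((1 : NNReal) : ℝ))) ≤ 1 := by
          rw [Real.exp_le_one_iff]
          push_cast
          nlinarith [sq_nonneg (x - 0)]
        exact mul_le_one₀ (inv_le_one_of_one_le₀ h1) (Real.exp_nonneg _) h2
    _ = volume := withDensity_one

lemma lintegral_enorm_rpow_gaussianReal_lt_top :
    ∫⁻ g, ‖g‖ₑ ^ (-(1 / 2) : ℝ) ∂(gaussianReal 0 1) < ∞ := by
  have hle : ∀ g : ℝ, ‖g‖ₑ ^ (-(1 / 2) : ℝ) ≤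
      (Set.Ioc (-1 : ℝ) 1).indicator (fun g : ℝ => ‖g‖ₑ ^ (-(1 / 2) : ℝ)) g + 1 := fun g => by
    by_cases hg : g ∈ Set.Ioc (-1 : ℝ) 1
    · rw [Set.indicator_of_mem hg]
      exact le_self_add
    · rw [Set.indicator_of_notMem hg, zero_add, ENNReal.rpow_neg, ENNReal.inv_le_one]
      refine ENNReal.one_le_rpow ?_ (by norm_num)
      have : 1 ≤ |g| := by
        by_contra! h
        exact hg ⟨(abs_lt.1 h).1, (abs_lt.1 h).2.le⟩
      rw [Real.enorm_eq_ofReal_abs]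
      exact ENNReal.one_le_ofReal.2 this
  have hind : ∫⁻ g in Set.Ioc (-1 : ℝ) 1, ‖g‖ₑ ^ (-(1 / 2) : ℝ) < ∞ := by
    have h := ((intervalIntegrable_iff_integrableOn_Ioc_of_le (by norm_num)).1
      intervalIntegrable_abs_rpow).2
    rw [HasFiniteIntegral] at h
    refine lt_of_eq_of_lt (lintegral_congr_ae ?_) h
    filter_upwards [ae_restrict_of_ae (Measure.ae_ne volume (0 : ℝ))] with x hx
    have hx' : 0 < |x| := abs_pos.2 hx
    rw [Real.enorm_eq_ofReal_abs, ENNReal.ofReal_rpow_of_pos hx',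
      Real.enorm_of_nonneg (by positivity)]
  calc ∫⁻ g, ‖g‖ₑ ^ (-(1 / 2) : ℝ) ∂(gaussianReal 0 1)
      ≤ ∫⁻ g, (Set.Ioc (-1 : ℝ) 1).indicator (fun g : ℝ => ‖g‖ₑ ^ (-(1 / 2) : ℝ)) g + 1
          ∂(gaussianReal 0 1) := lintegral_mono hle
    _ = (∫⁻ g, (Set.Ioc (-1 : ℝ) 1).indicator (fun g : ℝ => ‖g‖ₑ ^ (-(1 / 2) : ℝ)) g
          ∂(gaussianReal 0 1)) + 1 := by
        rw [lintegral_add_right _ measurable_const]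
        simp
    _ ≤ (∫⁻ g, (Set.Ioc (-1 : ℝ) 1).indicator (fun g : ℝ => ‖g‖ₑ ^ (-(1 / 2) : ℝ)) g) + 1 := by
        gcongr
        exact gaussianReal_le_volume
    _ < ∞ := by
        rw [lintegral_indicator measurableSet_Ioc]
        exact ENNReal.add_lt_top.2 ⟨hind, ENNReal.one_lt_top⟩

/-- A linear form in independent standard Gaussian variables is distributed as a multiple of one
standard Gaussian variable. -/
lemma map_gaussianPi_linear {d : ℕ} (b : Fin d → ℝ) :
    (gaussianPi d).map (fun x => ∑ i, x i * b i) =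
      (gaussianReal 0 1).map (fun g => √(∑ i, b i ^ 2) * g) := by
  let L : StrongDual ℝ (EuclideanSpace ℝ (Fin d)) := innerSL ℝ (WithLp.toLp 2 b)
  have hL : (fun x : Fin d → ℝ => ∑ i, x i * b i) = L ∘ WithLp.toLp 2 := by
    ext x
    simp [L, PiLp.inner_apply]
  rw [hL, ← Measure.map_map (by fun_prop) (by fun_prop), map_pi_eq_stdGaussian,
    IsGaussian.map_eq_gaussianReal, variance_dual_stdGaussian, integral_strongDual_stdGaussian,
    gaussianReal_map_const_mul]
  have hn : ‖L‖ = √(∑ i, b i ^ 2) := by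
    simp [L, EuclideanSpace.norm_eq]
  rw [hn, mul_zero, mul_one]
  congr 1
  ext
  simp [Real.coe_toNNReal', Finset.sum_nonneg, sq_nonneg]

lemma lintegral_gaussianPi_linear {d : ℕ} (b : Fin d → ℝ) :
    ∫⁻ x, ‖∑ i, x i * b i‖ₑ ^ (-(1 / 2) : ℝ) ∂(gaussianPi d) =
      ENNReal.ofReal (√(∑ i, b i ^ 2)) ^ (-(1 / 2) : ℝ) *
        ∫⁻ g, ‖g‖ₑ ^ (-(1 / 2) : ℝ) ∂(gaussianReal 0 1) := by
  have hm : Measurable fun g : ℝ => ‖g‖ₑ ^ (-(1 / 2) : ℝ) := by fun_prop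
  calc ∫⁻ x, ‖∑ i, x i * b i‖ₑ ^ (-(1 / 2) : ℝ) ∂(gaussianPi d)
      = ∫⁻ g, ‖g‖ₑ ^ (-(1 / 2) : ℝ) ∂((gaussianPi d).map (fun x => ∑ i, x i * b i)) :=
        (lintegral_map hm (by fun_prop)).symm
    _ = ∫⁻ g, ‖√(∑ i, b i ^ 2) * g‖ₑ ^ (-(1 / 2) : ℝ) ∂(gaussianReal 0 1) := by
        rw [map_gaussianPi_linear, lintegral_map hm (by fun_prop)]
    _ = _ := by
        rw [← lintegral_const_mul _ hm]
        refine lintegral_congr fun g => ?_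
        rw [enorm_mul, ENNReal.mul_rpow_of_ne_top enorm_ne_top enorm_ne_top,
          Real.enorm_of_nonneg (Real.sqrt_nonneg _)]

/-- A real Gaussian vector also serves complex coefficients `a`: one of the real and imaginary
parts of `a` carries at least half of the square of its Euclidean norm. -/
lemma exists_lintegral_gaussianPi_le (𝕜 : Type*) [RCLike 𝕜] : ∃ κ : ℝ, 0 < κ ∧
    ∀ (d : ℕ) (a : Fin d → 𝕜), 0 < √(∑ i, ‖a i‖ ^ 2) →
      ∫⁻ x, ENNReal.ofReal (√(√(∑ i, ‖a i‖ ^ 2)) / κ) *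
        ‖∑ i, (x i : 𝕜) * a i‖ₑ ^ (-(1 / 2) : ℝ) ∂(gaussianPi d) ≤ 1 := by
  set I := ∫⁻ g, ‖g‖ₑ ^ (-(1 / 2) : ℝ) ∂(gaussianReal 0 1) with hI
  have hItop : I ≠ ∞ := lintegral_enorm_rpow_gaussianReal_lt_top.ne
  refine ⟨√2 * (I.toReal + 1), by positivity, fun d a hs => ?_⟩
  set s := √(∑ i, ‖a i‖ ^ 2) with hsdef
  have hκ : 0 < √2 * (I.toReal + 1) := by positivity
  have hss : s ^ 2 = ∑ i, ‖a i‖ ^ 2 := Real.sq_sqrt (Finset.sum_nonneg fun _ _ => sq_nonneg _)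
  have hmeas : Measurable fun x : Fin d → ℝ => ‖∑ i, (x i : 𝕜) * a i‖ₑ ^ (-(1 / 2) : ℝ) := by
    have : Measurable fun x : Fin d → ℝ => ‖∑ i, (x i : 𝕜) * a i‖ₑ := by
      have : Continuous fun x : Fin d → ℝ => ∑ i, (x i : 𝕜) * a i := by fun_prop
      exact this.enorm.measurable
    fun_prop
  obtain ⟨b, hb, hbx⟩ : ∃ b : Fin d → ℝ, s / 2 ≤ √(∑ i, b i ^ 2) ∧
      ∀ x : Fin d → ℝ, |∑ i, x i * b i| ≤ ‖∑ i, (x i : 𝕜) * a i‖ := by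
    have hsum : s ^ 2 = ∑ i, RCLike.re (a i) ^ 2 + ∑ i, RCLike.im (a i) ^ 2 := by
      rw [hss, ← Finset.sum_add_distrib]
      exact Finset.sum_congr rfl fun i _ => by rw [RCLike.norm_sq_eq_def]; ring
    rcases le_total (∑ i, RCLike.im (a i) ^ 2) (∑ i, RCLike.re (a i) ^ 2) with h | h
    · refine ⟨fun i => RCLike.re (a i), Real.le_sqrt_of_sq_le (by nlinarith), fun x => ?_⟩
      refine le_of_eq_of_le ?_ (RCLike.abs_re_le_norm _)
      simp
    · refine ⟨fun i => RCLike.im (a i), Real.le_sqrt_of_sq_le (by nlinarith), fun x => ?_⟩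
      refine le_of_eq_of_le ?_ (RCLike.abs_im_le_norm _)
      simp
  have hpt : ∀ x : Fin d → ℝ, ‖∑ i, (x i : 𝕜) * a i‖ₑ ^ (-(1 / 2) : ℝ) ≤
      ‖∑ i, x i * b i‖ₑ ^ (-(1 / 2) : ℝ) := fun x => by
    rw [ENNReal.rpow_neg, ENNReal.rpow_neg, ENNReal.inv_le_inv]
    refine ENNReal.rpow_le_rpow ?_ (by norm_num)
    rw [Real.enorm_eq_ofReal_abs, ← ofReal_norm]
    exact ENNReal.ofReal_le_ofReal (hbx x)
  have hs2 : ENNReal.ofReal (√(∑ i, b i ^ 2)) ^ (-(1 / 2) : ℝ) ≤ ENNReal.ofReal (√2 / √s) := by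
    rw [ENNReal.ofReal_rpow_of_pos (by linarith)]
    refine ENNReal.ofReal_le_ofReal ?_
    rw [Real.rpow_neg (Real.sqrt_nonneg _), ← Real.sqrt_eq_rpow, ← Real.sqrt_div' _ hs.le,
      ← Real.sqrt_inv]
    refine Real.sqrt_le_sqrt ?_
    rw [← inv_div]
    exact inv_anti₀ (by positivity) hb
  rw [lintegral_const_mul _ hmeas]
  calc ENNReal.ofReal (√s / (√2 * (I.toReal + 1))) *
        ∫⁻ x, ‖∑ i, (x i : 𝕜) * a i‖ₑ ^ (-(1 / 2) : ℝ) ∂(gaussianPi d)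
      ≤ ENNReal.ofReal (√s / (√2 * (I.toReal + 1))) *
        ∫⁻ x, ‖∑ i, x i * b i‖ₑ ^ (-(1 / 2) : ℝ) ∂(gaussianPi d) :=
        mul_le_mul' le_rfl (lintegral_mono hpt)
    _ ≤ ENNReal.ofReal (√s / (√2 * (I.toReal + 1))) *
        (ENNReal.ofReal (√2 / √s) * ENNReal.ofReal (I.toReal + 1)) := by
        rw [lintegral_gaussianPi_linear]
        gcongr
        exact ENNReal.le_ofReal_iff_toReal_le hItop (by positivity) |>.2 (by linarith)
    _ = 1 := by
        have h0 : 0 < √s := Real.sqrt_pos.2 hs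
        rw [← ENNReal.ofReal_mul (by positivity), ← ENNReal.ofReal_mul (by positivity),
          ← ENNReal.ofReal_one]
        congr 1
        field_simp

/-- The probabilistic core of the upper bounds: some vector `x` simultaneously satisfies a size
constraint `∑ w (x i) ≤ 2 d M` and makes the product of the linear forms `a j` large. Its existence
follows by averaging one cost function, to which both requirements contribute at most `1` on
average. -/
lemma exists_prod_le_of_gaussian (𝕜 : Type*) [RCLike 𝕜] : ∃ K : ℝ, 0 < K ∧
    ∀ {d n : ℕ}, 1 ≤ d → 1 ≤ n → ∀ a : Fin n → Fin d → 𝕜, (∀ j, 0 < √(∑ i, ‖a j i‖ ^ 2)) →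
    ∀ (w : ℝ → ℝ) (M : ℝ), (∀ t, 0 ≤ w t) → Measurable w → Integrable w (gaussianReal 0 1) →
      0 < M → ∫ t, w t ∂(gaussianReal 0 1) ≤ M →
    ∃ x : Fin d → ℝ, ∑ i, w (x i) ≤ 2 * d * M ∧ (∀ j, ∑ i, (x i : 𝕜) * a j i ≠ 0) ∧
      ∏ j, √(∑ i, ‖a j i‖ ^ 2) ≤ K ^ n * ∏ j, ‖∑ i, (x i : 𝕜) * a j i‖ := by
  obtain ⟨κ, hκ, hκa⟩ := exists_lintegral_gaussianPi_le 𝕜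
  refine ⟨(2 * κ) ^ 2, by positivity, fun {d n} hd hn a ha w M hw0 hwm hwi hM hwM => ?_⟩
  have hd0 : (0 : ℝ) < d := by exact_mod_cast hd
  have hn0 : (0 : ℝ) < n := by exact_mod_cast hn
  set s : Fin n → ℝ := fun j => √(∑ i, ‖a j i‖ ^ 2) with hs
  let t : Fin n → (Fin d → ℝ) → ℝ≥0∞ := fun j x =>
    ENNReal.ofReal (√(s j) / κ) * ‖∑ i, (x i : 𝕜) * a j i‖ₑ ^ (-(1 / 2) : ℝ)
  have htm : ∀ j, Measurable (t j) := fun j => by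
    have : Measurable fun x : Fin d → ℝ => ‖∑ i, (x i : 𝕜) * a j i‖ₑ := by
      have : Continuous fun x : Fin d → ℝ => ∑ i, (x i : 𝕜) * a j i := by fun_prop
      exact this.enorm.measurable
    fun_prop
  have htI : ∀ j, ∫⁻ x, t j x ∂(gaussianPi d) ≤ 1 := fun j => hκa d (a j) (ha j)
  let F : (Fin d → ℝ) → ℝ≥0∞ := fun x =>
    ∑ i, ENNReal.ofReal (1 / (d * M)) * ENNReal.ofReal (w (x i))
  have hFm : Measurable F := by fun_prop
  have hFI : ∫⁻ x, F x ∂(gaussianPi d) ≤ 1 := by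
    have h1 : ∀ i : Fin d, ∫⁻ x, ENNReal.ofReal (w (x i)) ∂(gaussianPi d) ≤ ENNReal.ofReal M :=
      fun i => by
        rw [(measurePreserving_eval (fun _ : Fin d => gaussianReal 0 1) i).lintegral_comp
          (f := fun t => ENNReal.ofReal (w t)) (by fun_prop),
          ← ofReal_integral_eq_lintegral_ofReal hwi (ae_of_all _ hw0)]
        exact ENNReal.ofReal_le_ofReal hwM
    calc ∫⁻ x, F x ∂(gaussianPi d)
        = ∑ i : Fin d, ENNReal.ofReal (1 / (d * M)) *
            ∫⁻ x, ENNReal.ofReal (w (x i)) ∂(gaussianPi d) := by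
          rw [lintegral_finsetSum _ fun i _ => by fun_prop]
          exact Finset.sum_congr rfl fun i _ => lintegral_const_mul _ (by fun_prop)
      _ ≤ ∑ _i : Fin d, ENNReal.ofReal (1 / (d * M)) * ENNReal.ofReal M := by
          gcongr with i
          exact h1 i
      _ = 1 := by
          rw [Finset.sum_const, Finset.card_univ, Fintype.card_fin, nsmul_eq_mul,
            ← ENNReal.ofReal_natCast, ← ENNReal.ofReal_mul (by positivity),
            ← ENNReal.ofReal_mul (by positivity), ← ENNReal.ofReal_one]
          congr 1
          field_simp
  let H : (Fin d → ℝ) → ℝ≥0∞ := fun x => ∑ j, ENNReal.ofReal (1 / n) * t j x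
  have hHm : Measurable H := by fun_prop
  have hHI : ∫⁻ x, H x ∂(gaussianPi d) ≤ 1 := by
    calc ∫⁻ x, H x ∂(gaussianPi d)
        = ∑ j, ENNReal.ofReal (1 / n) * ∫⁻ x, t j x ∂(gaussianPi d) := by
          rw [lintegral_finsetSum _ fun i _ => by fun_prop]
          exact Finset.sum_congr rfl fun i _ => lintegral_const_mul _ (by fun_prop)
      _ ≤ ∑ _j : Fin n, ENNReal.ofReal (1 / n) * 1 := by
          gcongr with j
          exact htI j
      _ = 1 := by
          rw [Finset.sum_const, Finset.card_univ, Fintype.card_fin, nsmul_eq_mul, mul_one,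
            ← ENNReal.ofReal_natCast, ← ENNReal.ofReal_mul (by positivity), ← ENNReal.ofReal_one]
          congr 1
          field_simp
  obtain ⟨x, hx⟩ := exists_le_lintegral (μ := gaussianPi d) (f := fun x => F x + H x)
    (by fun_prop)
  rw [lintegral_add_left hFm] at hx
  have hx2 : F x + H x ≤ ENNReal.ofReal 2 :=
    (hx.trans (add_le_add hFI hHI)).trans (by rw [one_add_one_eq_two]; simp)
  have hFx : F x ≤ ENNReal.ofReal 2 := le_self_add.trans hx2
  have hHx : H x ≤ ENNReal.ofReal 2 := le_add_self.trans hx2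
  have hne : ∀ j, ∑ i, (x i : 𝕜) * a j i ≠ 0 := fun j h0 => by
    have h1 : ENNReal.ofReal (1 / n) * t j x ≤ H x :=
      Finset.single_le_sum (f := fun j => ENNReal.ofReal (1 / n) * t j x)
        (fun _ _ => zero_le) (Finset.mem_univ j)
    have h2 : 0 < √(s j) / κ := div_pos (Real.sqrt_pos.2 (ha j)) hκ
    have h3 : ENNReal.ofReal (1 / n) * t j x = ∞ := by
      simp only [t, h0, enorm_zero]
      rw [ENNReal.zero_rpow_of_neg (by norm_num), ENNReal.mul_top (by simpa using h2),
        ENNReal.mul_top (by simp; lia)]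
    rw [h3] at h1
    exact absurd (h1.trans hHx) (by simp)
  have hpos : ∀ j, 0 < ‖∑ i, (x i : 𝕜) * a j i‖ := fun j => norm_pos_iff.2 (hne j)
  refine ⟨x, ?_, hne, ?_⟩
  · have h1 : F x = ENNReal.ofReal (∑ i, 1 / (d * M) * w (x i)) := by
      rw [ENNReal.ofReal_sum_of_nonneg fun i _ => mul_nonneg (by positivity) (hw0 _)]
      exact Finset.sum_congr rfl fun i _ => (ENNReal.ofReal_mul (by positivity)).symm
    rw [h1, ENNReal.ofReal_le_ofReal_iff (by norm_num), ← Finset.mul_sum, one_div,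
      inv_mul_le_iff₀ (by positivity)] at hFx
    linarith
  · set z : Fin n → ℝ := fun j => √(s j) / κ * (√‖∑ i, (x i : 𝕜) * a j i‖)⁻¹ with hz
    have hz0 : ∀ j, 0 ≤ z j := fun j => by positivity
    have htz : ∀ j, t j x = ENNReal.ofReal (z j) := fun j => by
      simp only [t, hz]
      rw [← ofReal_norm, ENNReal.ofReal_rpow_of_pos (hpos j), Real.rpow_neg (hpos j).le,
        ← Real.sqrt_eq_rpow, ENNReal.ofReal_mul (by positivity)]
    have h1 : H x = ENNReal.ofReal (∑ j, 1 / n * z j) := by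
      rw [ENNReal.ofReal_sum_of_nonneg fun i _ => mul_nonneg (by positivity) (hz0 _)]
      refine Finset.sum_congr rfl fun i _ => ?_
      rw [ENNReal.ofReal_mul (by positivity), htz]
    rw [h1, ENNReal.ofReal_le_ofReal_iff (by norm_num), ← Finset.mul_sum, one_div,
      inv_mul_le_iff₀ (by positivity)] at hHx
    have h2 := prod_le_pow_card_of_sum_le Finset.univ z (fun j _ => hz0 j) (by simpa using hHx)
    rw [Finset.card_univ, Fintype.card_fin] at h2
    have h3 : ∀ j, s j = κ ^ 2 * z j ^ 2 * ‖∑ i, (x i : 𝕜) * a j i‖ := fun j => by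
      simp only [hz]
      rw [mul_pow, div_pow, inv_pow, Real.sq_sqrt (ha j).le, Real.sq_sqrt (hpos j).le]
      have := (hpos j).ne'
      field_simp
      rfl
    calc ∏ j, s j = (κ ^ 2) ^ n * (∏ j, z j) ^ 2 * ∏ j, ‖∑ i, (x i : 𝕜) * a j i‖ := by
          rw [Finset.prod_congr rfl fun j _ => h3 j, Finset.prod_mul_distrib,
            Finset.prod_mul_distrib, Finset.prod_const, Finset.card_univ, Fintype.card_fin,
            Finset.prod_pow]
      _ ≤ (κ ^ 2) ^ n * (2 ^ n) ^ 2 * ∏ j, ‖∑ i, (x i : 𝕜) * a j i‖ := by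
          gcongr
      _ = _ := by
          rw [← pow_mul 2 n 2, mul_comm n 2, pow_mul 2 2 n, ← mul_pow, mul_pow 2 κ 2,
            mul_comm (κ ^ 2)]

end Gaussian

/-! ### Upper bounds -/

section Upper

open MeasureTheory ProbabilityTheory

/-- Exponential bounds on the constants `c_n(ℓ_p^d)`: here `N` compares the `ℓ_2` and `ℓ_p` norms,
and `R` bounds the `ℓ_p` norm of real vectors on which the weight `w` is controlled. The constant
`K` is absolute. -/
lemma exists_pow_mem_polarizationBounds (𝕜 : Type*) [RCLike 𝕜] : ∃ K : ℝ, 0 < K ∧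
    ∀ (p : ℝ≥0∞) [Fact (1 ≤ p)] (d : ℕ), 1 ≤ d → ∀ (w : ℝ → ℝ) (M N R : ℝ),
      (∀ t, 0 ≤ w t) → Measurable w → Integrable w (gaussianReal 0 1) →
      0 < M → ∫ t, w t ∂(gaussianReal 0 1) ≤ M → 0 ≤ N → 0 ≤ R →
      (∀ x : EllP 𝕜 p d, ‖x‖ = 1 → ∑ i, ‖x i‖ ^ 2 ≤ N ^ 2) →
      (∀ x : Fin d → ℝ, ∑ i, w (x i) ≤ 2 * d * M →
        ‖(WithLp.toLp p fun i => (x i : 𝕜) : EllP 𝕜 p d)‖ ≤ R) →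
      ∀ n, (K * N * R) ^ n ∈ polarizationBounds 𝕜 (EllP 𝕜 p d) n := by
  obtain ⟨K, hK, hKa⟩ := exists_prod_le_of_gaussian 𝕜
  refine ⟨K, hK, fun p _ d hd w M N R hw0 hwm hwi hM hwM hN hR0 hcmp hR n ψ => ?_⟩
  rcases n.eq_zero_or_pos with rfl | hn
  · simpa using le_prodNorm ψ (x := PiLp.single p (⟨0, hd⟩ : Fin d) (1 : 𝕜)) (by simp)
  set s : Fin n → ℝ := fun j => √(∑ i, ‖ψ j (PiLp.single p i 1)‖ ^ 2) with hs
  have hψN : ∀ j, ‖ψ j‖ ≤ N * s j := fun j => norm_le_mul_sqrt_sum (ψ j) hN hcmp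
  have hs0 : ∀ j, 0 ≤ s j := fun j => Real.sqrt_nonneg _
  by_cases h : ∃ j, s j = 0
  · obtain ⟨j, hj⟩ := h
    have hψj : ‖ψ j‖ = 0 := le_antisymm (by simpa [hj] using hψN j) (norm_nonneg _)
    rw [Finset.prod_eq_zero (Finset.mem_univ j) hψj]
    exact mul_nonneg (by positivity) (prodNorm_nonneg ψ)
  push Not at h
  obtain ⟨x, hx, hne, hprod⟩ := hKa hd hn (fun j i => ψ j (PiLp.single p i 1))
    (fun j => (hs0 j).lt_of_ne (h j).symm) w M hw0 hwm hwi hM hwM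
  set y : EllP 𝕜 p d := WithLp.toLp p fun i => (x i : 𝕜) with hy
  have hψy : ∀ j, ψ j y = ∑ i, (x i : 𝕜) * ψ j (PiLp.single p i 1) := fun j => apply_eq_sum (ψ j) y
  have hy0 : y ≠ 0 := fun h0 => hne ⟨0, hn⟩ (by rw [← hψy, h0, map_zero])
  simp only [← hψy] at hprod
  calc ∏ j, ‖ψ j‖ ≤ ∏ j, (N * s j) :=
        Finset.prod_le_prod (fun _ _ => norm_nonneg _) fun j _ => hψN j
    _ = N ^ n * ∏ j, s j := by
        rw [Finset.prod_mul_distrib, Finset.prod_const, Finset.card_univ, Fintype.card_fin]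
    _ ≤ N ^ n * (K ^ n * ∏ j, ‖ψ j y‖) := by gcongr
    _ ≤ N ^ n * (K ^ n * (R ^ n * prodNorm ψ)) := by
        rw [← norm_prod]
        gcongr
        refine (norm_prod_apply_le_pow_mul_prodNorm ψ hy0).trans ?_
        gcongr
        · exact prodNorm_nonneg ψ
        · exact hR x hx
    _ = (K * N * R) ^ n * prodNorm ψ := by rw [mul_pow, mul_pow]; ring

/-- For finite `p` the weight `|t| ^ p` controls the `ℓ_p` norm. -/
lemma exists_pow_mem_polarizationBounds_of_ne_top (𝕜 : Type*) [RCLike 𝕜] (p : ℝ≥0∞)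
    [Fact (1 ≤ p)] (hp : p ≠ ∞) : ∃ L : ℝ, 0 < L ∧ ∀ d : ℕ, 1 ≤ d → ∀ N : ℝ, 0 ≤ N →
      (∀ x : EllP 𝕜 p d, ‖x‖ = 1 → ∑ i, ‖x i‖ ^ 2 ≤ N ^ 2) →
      ∀ n, (L * N * (d : ℝ) ^ (1 / p.toReal)) ^ n ∈ polarizationBounds 𝕜 (EllP 𝕜 p d) n := by
  obtain ⟨K, hK, hKa⟩ := exists_pow_mem_polarizationBounds 𝕜
  have h0 := toReal_pos_of_one_le hp
  have hw0 : ∀ t : ℝ, 0 ≤ |t| ^ p.toReal := fun t => by positivity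
  have hwi : Integrable (fun t : ℝ => |t| ^ p.toReal) (gaussianReal 0 1) := by
    simpa using (memLp_id_gaussianReal' p hp).integrable_norm_rpow
      (zero_lt_one.trans_le Fact.out).ne' hp
  set M := ∫ t, |t| ^ p.toReal ∂(gaussianReal 0 1) + 1 with hMdef
  have hM : 0 < M := add_pos_of_nonneg_of_pos (integral_nonneg hw0) one_pos
  refine ⟨K * (2 * M) ^ (1 / p.toReal), by positivity, fun d hd N hN hcmp n => ?_⟩
  have hmem := hKa p d hd (fun t => |t| ^ p.toReal) M N
    ((2 * M) ^ (1 / p.toReal) * d ^ (1 / p.toReal)) hw0 (by fun_prop) hwi hM (by linarith)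
    hN (by positivity) hcmp (fun x hx => by
      rw [PiLp.norm_eq_sum h0, ← Real.mul_rpow (by positivity) (by positivity)]
      refine Real.rpow_le_rpow (by positivity) ?_ (by positivity)
      simp only [RCLike.norm_ofReal]
      linarith) n
  convert hmem using 2
  ring

lemma integrable_exp_sq_gaussianReal :
    Integrable (fun t : ℝ => Real.exp (t ^ 2 / 4)) (gaussianReal 0 1) := by
  rw [gaussianReal_of_var_ne_zero 0 one_ne_zero, integrable_withDensity_iff
    (measurable_gaussianPDF 0 1) (ae_of_all _ fun _ => gaussianPDF_lt_top)]
  refine ((integrable_exp_neg_mul_sq (b := 1 / 4) (by norm_num)).const_mul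
    (√(2 * Real.pi))⁻¹).congr (ae_of_all _ fun t => ?_)
  simp only [toReal_gaussianPDF, gaussianPDFReal, NNReal.coe_one]
  rw [mul_left_comm, ← Real.exp_add]
  ring_nf

/-- For `p = ∞` the weight `exp (t ^ 2 / 4)` controls the maximum norm up to a logarithm. -/
lemma exists_pow_mem_polarizationBounds_top (𝕜 : Type*) [RCLike 𝕜] :
    ∃ L M : ℝ, 0 < L ∧ 1 ≤ M ∧ ∀ d : ℕ, 1 ≤ d → ∀ n,
      (L * √(d : ℝ) * √(Real.log (2 * d * M))) ^ n ∈ polarizationBounds 𝕜 (EllP 𝕜 ∞ d) n := by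
  obtain ⟨K, hK, hKa⟩ := exists_pow_mem_polarizationBounds 𝕜
  have hw0 : ∀ t : ℝ, 0 ≤ Real.exp (t ^ 2 / 4) := fun t => (Real.exp_pos _).le
  set M := ∫ t, Real.exp (t ^ 2 / 4) ∂(gaussianReal 0 1) + 1 with hMdef
  have hM : 1 ≤ M := le_add_of_nonneg_left (integral_nonneg hw0)
  refine ⟨K * 2, M, by positivity, hM, fun d hd n => ?_⟩
  have hd1 : (1 : ℝ) ≤ d := by exact_mod_cast hd
  have hmem := hKa ∞ d hd (fun t => Real.exp (t ^ 2 / 4)) M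
    ((d : ℝ) ^ (1 / 2 - 1 / (∞ : ℝ≥0∞).toReal)) (2 * √(Real.log (2 * d * M)))
    hw0 (by fun_prop) integrable_exp_sq_gaussianReal (by linarith) (by linarith) (by positivity)
    (by positivity) (fun x hx => sum_sq_le_of_two_le le_top hd hx) (fun x hx => by
      rw [PiLp.norm_eq_ciSup]
      refine Real.iSup_le (fun i => ?_) (by positivity)
      have h1 : Real.exp (x i ^ 2 / 4) ≤ 2 * d * M :=
        (Finset.single_le_sum (f := fun i => Real.exp (x i ^ 2 / 4)) (fun i _ => hw0 _)
          (Finset.mem_univ i)).trans hx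
      have h2 := (Real.le_log_iff_exp_le ((Real.exp_pos _).trans_le h1)).2 h1
      simp only [RCLike.norm_ofReal]
      calc |x i| = 2 * √(x i ^ 2 / 4) := by
            rw [show x i ^ 2 / 4 = (x i / 2) ^ 2 by ring, Real.sqrt_sq_eq_abs, abs_div]
            norm_num
            ring
        _ ≤ _ := by gcongr) n
  convert hmem using 2
  simp only [ENNReal.toReal_top, div_zero, sub_zero, ← Real.sqrt_eq_rpow]
  ring

end Upper

lemma exists_forall_pow_mem_polarizationBounds (𝕜 : Type*) [RCLike 𝕜] (p : ℝ≥0∞) [Fact (1 ≤ p)]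
    {d : ℕ} (hd : 1 ≤ d) : ∃ C : ℝ, ∀ n, C ^ n ∈ polarizationBounds 𝕜 (EllP 𝕜 p d) n := by
  rcases le_total p 2 with hp | hp
  · obtain ⟨L, -, hL⟩ := exists_pow_mem_polarizationBounds_of_ne_top 𝕜 p
      (ne_top_of_le_ne_top (by simp) hp)
    exact ⟨_, hL d hd 1 zero_le_one fun x hx => by simpa using sum_sq_le_of_le_two hp hx⟩
  · rcases eq_or_ne p ∞ with rfl | hp'
    · obtain ⟨L, M, -, -, hL⟩ := exists_pow_mem_polarizationBounds_top 𝕜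
      exact ⟨_, hL d hd⟩
    · obtain ⟨L, -, hL⟩ := exists_pow_mem_polarizationBounds_of_ne_top 𝕜 p hp'
      exact ⟨_, hL d hd _ (by positivity) fun x hx => sum_sq_le_of_two_le hp hd hx⟩

/-! ### Asymptotics of the polarization constants of `ℓ_p^d` -/

theorem theorem2p1 (𝕜 : Type*) [RCLike 𝕜] :
    -- the constants are well defined: `c_n` is a minimum and the limit `c` exists
    (∀ (p : ℝ≥0∞) [Fact (1 ≤ p)] (d : ℕ), 1 ≤ d →
      (∀ n : ℕ, IsLeast (polarizationBounds 𝕜 (EllP 𝕜 p d) n)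
        (nthPolarizationConst 𝕜 (EllP 𝕜 p d) n)) ∧
      Tendsto (fun n : ℕ => nthPolarizationConst 𝕜 (EllP 𝕜 p d) n ^ (1 / (n : ℝ))) atTop
        (𝓝 (polarizationConst 𝕜 (EllP 𝕜 p d)))) ∧
    (∀ (p : ℝ≥0∞) [Fact (1 ≤ p)], p ≤ 2 →
      AsympFrom 1 (fun d => polarizationConst 𝕜 (EllP 𝕜 p d))
        (fun d => (d : ℝ) ^ (1 / p.toReal))) ∧
    (∀ (p : ℝ≥0∞) [Fact (1 ≤ p)], 2 ≤ p → p ≠ ∞ →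
      AsympFrom 1 (fun d => polarizationConst 𝕜 (EllP 𝕜 p d)) (fun d => √(d : ℝ))) ∧
    PrecFrom 1 (fun d => √(d : ℝ)) (fun d => polarizationConst 𝕜 (EllP 𝕜 ∞ d)) ∧
    PrecFrom 2 (fun d => polarizationConst 𝕜 (EllP 𝕜 ∞ d))
      (fun d => √((d : ℝ) * Real.log d)) := by
  have hnt : ∀ (p : ℝ≥0∞) (d : ℕ), 1 ≤ d → Nontrivial (EllP 𝕜 p d) := fun p d hd =>
    have : Nonempty (Fin d) := ⟨⟨0, hd⟩⟩
    inferInstance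
  refine ⟨fun p _ d hd => ?_, fun p _ hp => ⟨?_, 1, one_pos, fun d hd => ?_⟩,
    fun p _ hp hp' => ⟨?_, 1, one_pos, fun d hd => ?_⟩, ⟨1, one_pos, fun d hd => ?_⟩, ?_⟩
  · have := hnt p d hd
    obtain ⟨C, hC⟩ := exists_forall_pow_mem_polarizationBounds 𝕜 p hd
    exact ⟨fun n => isLeast_nthPolarizationConst ⟨_, hC n⟩, (tendsto_nthPolarizationConst hC).1⟩
  · obtain ⟨L, hL0, hL⟩ := exists_pow_mem_polarizationBounds_of_ne_top 𝕜 p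
      (ne_top_of_le_ne_top (by simp) hp)
    refine ⟨L, hL0, fun d hd => ?_⟩
    have := hnt p d hd
    simpa using (tendsto_nthPolarizationConst (hL d hd 1 zero_le_one fun x hx => by
      simpa using sum_sq_le_of_le_two hp hx)).2.1
  · have := hnt p d hd
    obtain ⟨C, hC⟩ := exists_forall_pow_mem_polarizationBounds 𝕜 p hd
    rw [one_mul]
    exact rpow_le_polarizationConst (ne_top_of_le_ne_top (by simp) hp) hd hC
  · obtain ⟨L, hL0, hL⟩ := exists_pow_mem_polarizationBounds_of_ne_top 𝕜 p hp'
    refine ⟨L, hL0, fun d hd => ?_⟩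
    have := hnt p d hd
    have hd0 : (0 : ℝ) < d := by exact_mod_cast hd
    have h := (tendsto_nthPolarizationConst (hL d hd _ (by positivity)
      fun x hx => sum_sq_le_of_two_le hp hd hx)).2.1
    rwa [mul_assoc, ← Real.rpow_add hd0, sub_add_cancel, ← Real.sqrt_eq_rpow] at h
  · have := hnt p d hd
    obtain ⟨C, hC⟩ := exists_forall_pow_mem_polarizationBounds 𝕜 p hd
    rw [one_mul]
    exact sqrt_le_polarizationConst hp hd hC
  · have := hnt ∞ d hd
    obtain ⟨C, hC⟩ := exists_forall_pow_mem_polarizationBounds 𝕜 ∞ hd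
    rw [one_mul]
    exact sqrt_le_polarizationConst le_top hd hC
  · obtain ⟨L, M, hL0, hM, hL⟩ := exists_pow_mem_polarizationBounds_top 𝕜
    have hlog2 : 0 < Real.log 2 := Real.log_pos (by norm_num)
    have hlogM : 0 ≤ Real.log (2 * M) := Real.log_nonneg (by linarith)
    refine ⟨L * √(1 + Real.log (2 * M) / Real.log 2), by positivity, fun d hd => ?_⟩
    have := hnt ∞ d (by lia)
    have hd2 : (2 : ℝ) ≤ d := by exact_mod_cast hd
    have h := (tendsto_nthPolarizationConst (hL d (by lia))).2.1
    refine h.trans ?_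
    -- since `log 2 ≤ log d`, the constant `log (2 * M)` is absorbed into a multiple of `log d`
    have hle : Real.log (2 * d * M) ≤ (1 + Real.log (2 * M) / Real.log 2) * Real.log d := by
      have h1 : Real.log 2 ≤ Real.log d := Real.log_le_log (by norm_num) hd2
      have h2 : Real.log (2 * d * M) = Real.log d + Real.log (2 * M) := by
        rw [← Real.log_mul (by positivity) (by positivity)]
        ring_nf
      have h3 : Real.log (2 * M) = Real.log (2 * M) / Real.log 2 * Real.log 2 := by field_simp
      have h4 : Real.log (2 * M) / Real.log 2 * Real.log 2 ≤
          Real.log (2 * M) / Real.log 2 * Real.log d := by gcongr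
      linarith
    calc L * √(d : ℝ) * √(Real.log (2 * d * M))
        ≤ L * √(d : ℝ) * √((1 + Real.log (2 * M) / Real.log 2) * Real.log d) := by gcongr
      _ = L * √(1 + Real.log (2 * M) / Real.log 2) * √((d : ℝ) * Real.log d) := by
          rw [Real.sqrt_mul (by positivity), Real.sqrt_mul (by positivity)]
          ring
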